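/- Let $G$ be a real, connected, compact, semisimple Lie group (finite-dimensional, Hausdorff; semisimple means that the Lie algebra $\mathfrak g$ of $G$ has zero solvable radical). Let $\mathcal X$ be a linear vector field on $G$, i.e. a smooth vector field whose flow $(\varphi_t)_{t\in\mathbb R}$, given by $\frac{d}{dt}\varphi_t(g)=\mathcal X(\varphi_t(g))$ and $\varphi_0(g)=g$, is defined for all $t \in \mathbb R$ and consists of Lie group automorphisms of $G$. Then every fixed point $g$ of the flow $\varphi_t$ (that is, $\varphi_t(g)=g$ for all $t\in\mathbb R$) is Lyapunov stable: for every neighborhood $U$ of $g$ there is a neighborhood $V$ of $g$ such that $\varphi_t(V)\subset U$ for all $t\ge 0$. -/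

import Mathlib

open scoped Manifold ContDiff Topology

section LinearFlow

variable {E : Type*} [NormedAddCommGroup E] [NormedSpace ℝ E]
  {H : Type*} [TopologicalSpace H] (I : ModelWithCorners ℝ E H)
  {G : Type*} [TopologicalSpace G] [ChartedSpace H G] [Group G]

/-- A smooth real Lie group has the regularity under which Mathlib equips `GroupLieAlgebra I G`
with its Lie algebra structure. -/
instance LieGroup.minSmoothness_of_smooth [LieGroup I ∞ G] :
    LieGroup I (minSmoothness ℝ 3) G := by
  rw [minSmoothness_of_isRCLikeNormedField]
  infer_instance

variable (G) in
/-- A real Lie group is semisimple if its Lie algebra is, that is, if the largest solvable ideal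
of its Lie algebra is zero. -/
def IsSemisimpleLieGroup [FiniteDimensional ℝ E] [LieGroup I ∞ G] : Prop :=
  haveI : CompleteSpace E := FiniteDimensional.complete ℝ E
  LieAlgebra.HasTrivialRadical ℝ (GroupLieAlgebra I G)

/-- `φ` is the (global) flow of the vector field `X`: for every `g`, the curve `t ↦ φ t g`,
defined for all real `t`, solves `ġ = X(g)` with initial value `g`. -/
structure IsFlowOf (φ : ℝ → G → G) (X : (g : G) → TangentSpace I g) : Prop where
  zero_apply : ∀ g : G, φ 0 g = g
  isMIntegralCurve : ∀ g : G, IsMIntegralCurve (I := I) (fun t => φ t g) X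

/-- `f` is an automorphism of the Lie group `G`: a group automorphism that is a diffeomorphism. -/
def IsLieGroupAutomorphism (f : G → G) : Prop :=
  ∃ e : G ≃* G, ⇑e = f ∧ ContMDiff I I ∞ e ∧ ContMDiff I I ∞ e.symm

/-- A smooth vector field on a Lie group is linear if it has a global flow which consists of
automorphisms of the Lie group. -/
structure IsLinearVectorField [LieGroup I ∞ G] (X : (g : G) → TangentSpace I g) : Prop where
  contMDiff : ContMDiff I I.tangent ∞ (fun g => (⟨g, X g⟩ : TangentBundle I G))
  exists_flow : ∃ φ : ℝ → G → G, IsFlowOf I φ X ∧ ∀ t : ℝ, IsLieGroupAutomorphism I (φ t)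

end LinearFlow

/-- `g` is a fixed point of the flow `φ`. -/
def IsFlowFixedPoint {G : Type*} (φ : ℝ → G → G) (g : G) : Prop :=
  ∀ t : ℝ, φ t g = g

/-- Lyapunov stability of the point `g`: every neighbourhood `U` of `g` contains all forward images
`φ t '' V`, `t ≥ 0`, of some neighbourhood `V` of `g`. -/
def IsStablePoint {G : Type*} [TopologicalSpace G] (φ : ℝ → G → G) (g : G) : Prop :=
  ∀ U ∈ 𝓝 g, ∃ V ∈ 𝓝 g, ∀ t : ℝ, 0 ≤ t → φ t '' V ⊆ U

/-! The function F(x) = tr Ad(g⁻¹x) is a conserved quantity with a strict local maximum at the fixed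
point g, and this forces stability.

Conservation: an automorphism f gives Ad(f h) conjugate to Ad(h)
(`trace_adjointAction_automorphism`), and φ_t fixes g, so φ_t(g⁻¹x) = g⁻¹φ_t(x). Maximum: by
compactness Ad preserves an inner product (`exists_invariant_inner`), so tr Ad(h) is at most the
dimension, with equality only when Ad(h) is the identity
(`LinearMap.trace_lt_finrank_of_inner_invariant`). Semisimplicity kills the centre of the Lie
algebra, so Ad(h) ≠ id for h ≠ 1 near 1 (`eventually_adjointAction_ne_id`). Stability: orbits stay
on level sets of F, so one starting close to g cannot cross the boundary of a small neighbourhood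
(`isStablePoint_of_strict_max`).

No exponential map is used. In a chart at 1, the difference of the derivatives at 1 of left and
right translation by p vanishes when Ad(p) = id; its derivative in p is the antisymmetrised second
derivative of multiplication, which is the Lie bracket. -/

/-! ### Symmetry of mixed second derivatives -/

section Calculus

variable {E : Type*} [NormedAddCommGroup E] [NormedSpace ℝ E]

/-- The mixed second derivative of a map of two variables: derivatives at `(o, o)` of the two
partial derivatives, the one with respect to the second variable along the first axis and the one
with respect to the first variable along the second axis. -/
theorem exists_hasFDerivAt_partial {m : E × E → E} {o : E} (hm : ContDiffAt ℝ 2 m (o, o)) :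
    ∃ B C : E →L[ℝ] E →L[ℝ] E,
      HasFDerivAt (fun p => fderiv ℝ (fun q => m (p, q)) o) B o ∧
      HasFDerivAt (fun p => fderiv ℝ (fun q => m (q, p)) o) C o ∧
      ∀ v w, C v w = B w v := by
  have hD : DifferentiableAt ℝ (fderiv ℝ m) (o, o) :=
    (hm.fderiv_right (m := 1) (by norm_num)).differentiableAt (by norm_num)
  have hdiff : ∀ᶠ z in 𝓝 (o, o), DifferentiableAt ℝ m z := by
    filter_upwards [hm.eventually (by simp)] with z hz
    exact hz.differentiableAt (by norm_num)
  have hsymm : IsSymmSndFDerivAt ℝ m (o, o) := hm.isSymmSndFDerivAt (by simp)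
  have hl : HasFDerivAt (fun p : E => (p, o)) (ContinuousLinearMap.inl ℝ E E) o :=
    hasFDerivAt_prodMk_left o o
  have hr : HasFDerivAt (fun p : E => (o, p)) (ContinuousLinearMap.inr ℝ E E) o :=
    hasFDerivAt_prodMk_right o o
  have hl' : ∀ᶠ p in 𝓝 o, DifferentiableAt ℝ m (p, o) := hl.continuousAt.eventually hdiff
  have hr' : ∀ᶠ p in 𝓝 o, DifferentiableAt ℝ m (o, p) := hr.continuousAt.eventually hdiff
  -- The partial derivative in the second variable is the full derivative composed with `inr`, so it
  -- is differentiated through the linear map `T ↦ T ∘ inr`.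
  have hB := ((ContinuousLinearMap.compL ℝ E (E × E) E).flip
    (ContinuousLinearMap.inr ℝ E E)).hasFDerivAt.comp o (HasFDerivAt.comp (g := fderiv ℝ m) (f := fun p : E => (p, o)) o hD.hasFDerivAt hl)
  have hC := ((ContinuousLinearMap.compL ℝ E (E × E) E).flip
    (ContinuousLinearMap.inl ℝ E E)).hasFDerivAt.comp o (HasFDerivAt.comp (g := fderiv ℝ m) (f := fun p : E => (o, p)) o hD.hasFDerivAt hr)
  refine ⟨_, _, hB.congr_of_eventuallyEq ?_, hC.congr_of_eventuallyEq ?_, ?_⟩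
  · filter_upwards [hl'] with p hp
    exact (hp.hasFDerivAt.comp o (hasFDerivAt_prodMk_right p o)).fderiv
  · filter_upwards [hr'] with p hp
    exact (hp.hasFDerivAt.comp o (hasFDerivAt_prodMk_left o p)).fderiv
  · intro v w
    exact hsymm.eq _ _

end Calculus

/-! ### Traces of orthogonal operators and averaging over a compact group -/

section LinearAlgebra

/-- An endomorphism preserving an inner product has trace at most the dimension, with equality only
for the identity. -/
theorem LinearMap.trace_lt_finrank_of_inner_invariant {V : Type*} [AddCommGroup V] [Module ℝ V]
    [FiniteDimensional ℝ V] (c : InnerProductSpace.Core ℝ V) (A : V →ₗ[ℝ] V)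
    (hA : ∀ x, c.inner (A x) (A x) = c.inner x x) (hne : A ≠ LinearMap.id) :
    LinearMap.trace ℝ V A < Module.finrank ℝ V := by
  let _ : NormedAddCommGroup V := c.toNormedAddCommGroup
  let _ : InnerProductSpace ℝ V := InnerProductSpace.ofCore c.toCore
  have hA' : ∀ x, inner ℝ (A x) (A x) = inner ℝ x x := hA
  let b := stdOrthonormalBasis ℝ V
  have hexp : ∀ x, inner ℝ (A x - x) (A x - x) = 2 * inner ℝ x x - 2 * inner ℝ x (A x) := by
    intro x
    rw [inner_sub_left, inner_sub_right, inner_sub_right, hA', real_inner_comm x (A x)]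
    ring
  have hle : ∀ i, inner ℝ (b i) (A (b i)) ≤ 1 := by
    intro i
    have h1 := hexp (b i)
    have h2 : 0 ≤ inner ℝ (A (b i) - b i) (A (b i) - b i) := real_inner_self_nonneg
    have h3 : inner ℝ (b i) (b i) = (1 : ℝ) := by simp
    linarith
  have htr : LinearMap.trace ℝ V A = ∑ i, inner ℝ (b i) (A (b i)) :=
    LinearMap.trace_eq_sum_inner A b
  obtain ⟨i, hi⟩ : ∃ i, A (b i) ≠ b i := by
    by_contra! h
    exact hne (b.toBasis.ext fun i => by simpa using h i)
  have hlt : inner ℝ (b i) (A (b i)) < 1 := by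
    have h1 := hexp (b i)
    have h2 : 0 < inner ℝ (A (b i) - b i) (A (b i) - b i) :=
      real_inner_self_pos.2 (sub_ne_zero.2 hi)
    have h3 : inner ℝ (b i) (b i) = (1 : ℝ) := by simp
    linarith
  rw [htr]
  calc ∑ i, inner ℝ (b i) (A (b i)) < ∑ _i : Fin (Module.finrank ℝ V), (1 : ℝ) :=
        Finset.sum_lt_sum (fun i _ => hle i) ⟨i, Finset.mem_univ i, hlt⟩
    _ = Module.finrank ℝ V := by simp

open MeasureTheory in
/-- A continuous finite-dimensional representation of a compact group has an invariant inner
product. -/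
theorem exists_invariant_inner {E : Type*} [NormedAddCommGroup E] [NormedSpace ℝ E]
    [FiniteDimensional ℝ E] {G : Type*} [TopologicalSpace G] [Group G] [IsTopologicalGroup G]
    [T2Space G] [CompactSpace G] (ρ : G → E →L[ℝ] E) (hρ : Continuous ρ)
    (hmul : ∀ a b, ρ (a * b) = (ρ a).comp (ρ b)) (hone : ρ 1 = ContinuousLinearMap.id ℝ E) :
    ∃ c : InnerProductSpace.Core ℝ E, ∀ a x y, c.inner (ρ a x) (ρ a y) = c.inner x y := by
  let _ : MeasurableSpace G := borel G
  have : BorelSpace G := ⟨rfl⟩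
  let μ : Measure G := Measure.haar
  let T := toEuclidean (E := E)
  -- The inverse in `ρ a⁻¹` turns the action of `h` into the left translation `a ↦ h⁻¹ * a`, under
  -- which Haar measure is invariant.
  have hcont : ∀ x y : E, Continuous fun a : G => inner ℝ (T (ρ a⁻¹ x)) (T (ρ a⁻¹ y)) := by
    intro x y
    have h : ∀ z : E, Continuous fun a : G => T (ρ a⁻¹ z) := fun z =>
      T.continuous.comp ((hρ.comp continuous_inv).clm_apply continuous_const)
    exact (h x).inner (h y)
  have hint : ∀ x y : E, Integrable (fun a : G => inner ℝ (T (ρ a⁻¹ x)) (T (ρ a⁻¹ y))) μ :=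
    fun x y => (hcont x y).integrable_of_hasCompactSupport (HasCompactSupport.of_compactSpace _)
  refine ⟨{ inner := fun x y => ∫ a, inner ℝ (T (ρ a⁻¹ x)) (T (ρ a⁻¹ y)) ∂μ
            conj_inner_symm := ?_
            re_inner_nonneg := ?_
            add_left := ?_
            smul_left := ?_
            definite := ?_ }, ?_⟩
  · intro x y
    simp only [conj_trivial]
    exact integral_congr_ae (.of_forall fun a => real_inner_comm _ _)
  · intro x
    exact integral_nonneg fun a => real_inner_self_nonneg
  · intro x y z
    simp only [map_add, inner_add_left]
    exact integral_add (hint x z) (hint y z)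
  · intro x y r
    simp only [map_smul, real_inner_smul_left, conj_trivial]
    exact integral_const_mul _ _
  · intro x hx
    by_contra hne
    have hpos := (hcont x x).integral_pos_of_hasCompactSupport_nonneg_nonzero (μ := μ)
      (HasCompactSupport.of_compactSpace _) (fun a => real_inner_self_nonneg) (x := 1) (by
        simp [hone, hne])
    exact hpos.ne' hx
  · intro h x y
    have := integral_mul_left_eq_self (μ := μ)
      (fun a : G => inner ℝ (T (ρ a⁻¹ x)) (T (ρ a⁻¹ y))) h⁻¹
    simp only [mul_inv_rev, inv_inv, hmul, ContinuousLinearMap.comp_apply] at this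
    exact this

end LinearAlgebra

/-! ### Stability from a conserved quantity -/

section Topology

/-- A point at which a continuous first integral has a strict local maximum is stable. -/
theorem isStablePoint_of_strict_max {G : Type*} [TopologicalSpace G] [T2Space G] [CompactSpace G]
    {φ : ℝ → G → G} {g : G} (h0 : ∀ x, φ 0 x = x) (hcont : ∀ x, Continuous fun t => φ t x)
    {F : G → ℝ} (hF : Continuous F) (hinv : ∀ t x, F (φ t x) = F x)
    (hmax : ∀ᶠ x in 𝓝[≠] g, F x < F g) : IsStablePoint φ g := by
  intro U hU
  rw [eventually_nhdsWithin_iff] at hmax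
  obtain ⟨K, ⟨hKn, hKc⟩, hKs⟩ :=
    (closed_nhds_basis g).mem_iff.1 (Filter.inter_mem hU hmax)
  set W := interior K
  have hgW : g ∈ W := mem_interior_iff_mem_nhds.2 hKn
  have hfr : ∀ x ∈ frontier W, F x < F g := fun x hx =>
    (hKs (hKc.closure_interior_subset (frontier_subset_closure hx))).2 fun h => by
      rw [isOpen_interior.frontier_eq] at hx
      exact hx.2 (h ▸ hgW)
  have hfc : IsCompact (frontier W) := isClosed_frontier.isCompact
  -- The level `c` is the maximum of `F` on the compact frontier; any value below `F g` serves if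
  -- the frontier is empty.
  obtain ⟨c, hcg, hc⟩ : ∃ c < F g, ∀ x ∈ frontier W, F x ≤ c := by
    rcases (frontier W).eq_empty_or_nonempty with h | h
    · exact ⟨F g - 1, by linarith, by simp [h]⟩
    · obtain ⟨x, hx, hxm⟩ := hfc.exists_isMaxOn h hF.continuousOn
      exact ⟨F x, hfr x hx, fun y hy => hxm hy⟩
  refine ⟨W ∩ {x | c < F x}, Filter.inter_mem (isOpen_interior.mem_nhds hgW)
    ((isOpen_lt continuous_const hF).mem_nhds hcg), ?_⟩
  rintro t - _ ⟨x, ⟨hxW, hxc⟩, rfl⟩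
  refine (hKs (interior_subset ?_)).1
  by_contra hn
  -- The orbit is connected and, since `F > c` along it, misses the frontier; were it to leave `W`,
  -- the open sets `W` and `(closure W)ᶜ` would disconnect it.
  have hpre : IsPreconnected (Set.range fun s => φ s x) := isPreconnected_range (hcont x)
  have hnot : ∀ s, φ s x ∉ frontier W := fun s hs =>
    absurd (hinv s x ▸ hc _ hs) (not_le.2 hxc)
  have hout : ∀ s, φ s x ∉ W → φ s x ∈ (closure W)ᶜ := fun s hs hcl =>
    hnot s (by rw [isOpen_interior.frontier_eq]; exact ⟨hcl, hs⟩)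
  obtain ⟨y, -, hy, hy'⟩ := hpre W (closure W)ᶜ isOpen_interior isClosed_closure.isOpen_compl
    (by rintro _ ⟨s, rfl⟩; exact (em _).imp id (hout s))
    ⟨x, ⟨0, h0 x⟩, hxW⟩ ⟨φ t x, ⟨t, rfl⟩, hout t hn⟩
  exact hy' (subset_closure hy)

end Topology

/-! ### The adjoint action in a chart at the identity -/

section LieGroup

variable {E : Type*} [NormedAddCommGroup E] [NormedSpace ℝ E]
  {H : Type*} [TopologicalSpace H] (I : ModelWithCorners ℝ E H)
  {G : Type*} [TopologicalSpace G] [ChartedSpace H G] [Group G]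

/-- The derivative at the identity of a self-map of a Lie group, read in the preferred chart at the
identity. It is meaningful for maps fixing the identity. -/
noncomputable def derivAtOne (f : G → G) : E →L[ℝ] E :=
  fderiv ℝ (fun q => extChartAt I (1 : G) (f ((extChartAt I (1 : G)).symm q))) (extChartAt I (1 : G) 1)

/-- The adjoint action of an element of a Lie group, read in the preferred chart at the identity. -/
noncomputable def adjointAction (h : G) : E →L[ℝ] E :=
  derivAtOne I (fun x => h * x * h⁻¹)

theorem contMDiff_conj [LieGroup I ∞ G] (h : G) : ContMDiff I I ∞ (fun x : G => h * x * h⁻¹) :=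
  (contMDiff_const.mul contMDiff_id).mul contMDiff_const

variable [I.Boundaryless]

variable (G) in
theorem contMDiffAt_extChartAt_symm_one [IsManifold I ∞ G] :
    ContMDiffAt 𝓘(ℝ, E) I ∞ (extChartAt I (1 : G)).symm (extChartAt I (1 : G) 1) :=
  (contMDiffOn_extChartAt_symm (I := I) (n := ∞) (1 : G)).contMDiffAt
    (extChartAt_target_mem_nhds (1 : G))

theorem contDiffAt_chart_of_map_one [IsManifold I ∞ G] {f : G → G} (hf : ContMDiffAt I I ∞ f 1)
    (h1 : f 1 = 1) :
    ContDiffAt ℝ ∞ (fun q => extChartAt I (1 : G) (f ((extChartAt I (1 : G)).symm q)))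
      (extChartAt I (1 : G) 1) := by
  rw [← contMDiffAt_iff_contDiffAt]
  have hs : (extChartAt I (1 : G)).symm (extChartAt I (1 : G) 1) = 1 := extChartAt_to_inv _
  refine ContMDiffAt.comp_of_eq (I' := I) (y := f 1)
    (g := extChartAt I (1 : G)) (f := fun q => f ((extChartAt I (1 : G)).symm q)) ?_ ?_ ?_
  · rw [h1]; exact contMDiffAt_extChartAt
  · exact ContMDiffAt.comp_of_eq hf (contMDiffAt_extChartAt_symm_one I G) hs
  · rw [hs]

/-- Both maps fix the identity, so one chart serves at every stage and the chain rule becomes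
composition of operators on `E`. -/
theorem derivAtOne_comp [IsManifold I ∞ G] {f g : G → G} (hf : ContMDiffAt I I ∞ f 1)
    (hf1 : f 1 = 1) (hg : ContMDiffAt I I ∞ g 1) (hg1 : g 1 = 1) :
    derivAtOne I (fun x => f (g x)) = (derivAtOne I f).comp (derivAtOne I g) := by
  have hs : (extChartAt I (1 : G)).symm (extChartAt I (1 : G) 1) = 1 := extChartAt_to_inv _
  have hval : extChartAt I (1 : G) (g ((extChartAt I (1 : G)).symm (extChartAt I (1 : G) 1))) =
      extChartAt I (1 : G) 1 := by rw [hs, hg1]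
  have hF := (contDiffAt_chart_of_map_one I hf hf1).differentiableAt (by simp)
  have hG := (contDiffAt_chart_of_map_one I hg hg1).differentiableAt (by simp)
  have hF' : HasFDerivAt (fun q => extChartAt I (1 : G) (f ((extChartAt I (1 : G)).symm q)))
      (derivAtOne I f)
      (extChartAt I (1 : G) (g ((extChartAt I (1 : G)).symm (extChartAt I (1 : G) 1)))) := by
    rw [hval]; exact hF.hasFDerivAt
  have hcomp := hF'.comp (extChartAt I (1 : G) 1) hG.hasFDerivAt
  refine HasFDerivAt.fderiv (hcomp.congr_of_eventuallyEq ?_)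
  have hcont : ContinuousAt (fun q => g ((extChartAt I (1 : G)).symm q)) (extChartAt I (1 : G) 1) :=
    ContinuousAt.comp_of_eq hg.continuousAt
      (contMDiffAt_extChartAt_symm_one I G).continuousAt hs
  have hsrc : (extChartAt I (1 : G)).source ∈
      𝓝 (g ((extChartAt I (1 : G)).symm (extChartAt I (1 : G) 1))) := by
    rw [hs, hg1]; exact extChartAt_source_mem_nhds _
  filter_upwards [hcont hsrc] with q hq
  exact congrArg (fun z => extChartAt I (1 : G) (f z)) ((extChartAt I (1 : G)).left_inv hq).symm

theorem derivAtOne_id : derivAtOne I (fun x : G => x) = ContinuousLinearMap.id ℝ E := by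
  refine HasFDerivAt.fderiv ((hasFDerivAt_id _).congr_of_eventuallyEq ?_)
  filter_upwards [extChartAt_target_mem_nhds (I := I) (1 : G)] with q hq
  exact (extChartAt I (1 : G)).right_inv hq

theorem adjointAction_one : adjointAction I (1 : G) = ContinuousLinearMap.id ℝ E := by
  rw [← derivAtOne_id I (G := G), adjointAction]
  simp

variable [LieGroup I ∞ G]

theorem adjointAction_mul (a b : G) :
    adjointAction I (a * b) = (adjointAction I a).comp (adjointAction I b) := by
  have := derivAtOne_comp I (contMDiff_conj I a).contMDiffAt (by simp)
    (contMDiff_conj I b).contMDiffAt (by simp)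
  rw [adjointAction, adjointAction, adjointAction, ← this]
  congr 1
  ext x
  group

/-- Conjugation is jointly smooth in the conjugating element and the chart point, so its derivative
in the latter depends continuously on the former. -/
theorem continuous_adjointAction : Continuous (adjointAction I : G → E →L[ℝ] E) := by
  rw [continuous_iff_continuousAt]
  intro h
  have hs : (extChartAt I (1 : G)).symm (extChartAt I (1 : G) 1) = 1 := extChartAt_to_inv _
  let f : G → E → E := fun h q =>
    extChartAt I (1 : G) (h * (extChartAt I (1 : G)).symm q * h⁻¹)
  have hf : ContMDiffAt (I.prod 𝓘(ℝ, E)) 𝓘(ℝ, E) ∞ (Function.uncurry f)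
      (h, extChartAt I (1 : G) 1) := by
    have hsymm : ContMDiffAt (I.prod 𝓘(ℝ, E)) I ∞
        (fun z : G × E => (extChartAt I (1 : G)).symm z.2) (h, extChartAt I (1 : G) 1) :=
      ContMDiffAt.comp_of_eq (contMDiffAt_extChartAt_symm_one I G) contMDiffAt_snd rfl
    have hconj : ContMDiffAt (I.prod 𝓘(ℝ, E)) I ∞
        (fun z : G × E => z.1 * (extChartAt I (1 : G)).symm z.2 * z.1⁻¹)
        (h, extChartAt I (1 : G) 1) :=
      (contMDiffAt_fst.mul hsymm).mul contMDiffAt_fst.inv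
    refine ContMDiffAt.comp_of_eq (I' := I) (y := (1 : G)) (g := extChartAt I (1 : G))
      contMDiffAt_extChartAt hconj ?_
    rw [hs]; group
  have := ContMDiffAt.mfderiv (m := 0) f (fun _ => extChartAt I (1 : G) 1) hf contMDiffAt_const
    (by simp)
  have hmodel := inTangentCoordinates_model_space (I := 𝓘(ℝ, E)) (I' := 𝓘(ℝ, E))
    (fun _ : G => extChartAt I (1 : G) 1) (fun x => f x (extChartAt I (1 : G) 1))
    (fun x => fderiv ℝ (f x) (extChartAt I (1 : G) 1)) h
  simp only [mfderiv_eq_fderiv] at this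
  have hsmooth : ContMDiffAt I 𝓘(ℝ, E →L[ℝ] E) 0
      (fun x => fderiv ℝ (f x) (extChartAt I (1 : G) 1)) h := by
    rw [← hmodel]; exact this
  exact hsmooth.continuousAt

/-- The character of the adjoint action is invariant under automorphisms, since the adjoint action of
the image of an element is conjugate to the adjoint action of the element. -/
theorem trace_adjointAction_automorphism [FiniteDimensional ℝ E] {f : G → G}
    (hf : IsLieGroupAutomorphism I f) (h : G) :
    LinearMap.trace ℝ E (adjointAction I (f h)) = LinearMap.trace ℝ E (adjointAction I h) := by
  obtain ⟨e, rfl, he, he'⟩ := hf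
  -- Conjugation by `e h` is `e ∘ (conjugation by h) ∘ e.symm`.
  have h1 : adjointAction I (e h) =
      (derivAtOne I e).comp ((adjointAction I h).comp (derivAtOne I e.symm)) := by
    rw [adjointAction, adjointAction, ← derivAtOne_comp I (contMDiff_conj I h).contMDiffAt (by simp)
      he'.contMDiffAt (map_one _), ← derivAtOne_comp I he.contMDiffAt (map_one _)
      (g := fun x => h * e.symm x * h⁻¹) ((contMDiff_conj I h).comp he').contMDiffAt (by simp)]
    simp
  have h2 : (derivAtOne I e.symm).comp (derivAtOne I e) = ContinuousLinearMap.id ℝ E := by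
    rw [← derivAtOne_comp I he'.contMDiffAt (map_one _) he.contMDiffAt (map_one _)]
    simpa using derivAtOne_id I (G := G)
  rw [h1, ContinuousLinearMap.toLinearMap_comp, LinearMap.trace_comp_comm',
    ← ContinuousLinearMap.toLinearMap_comp, ContinuousLinearMap.comp_assoc, h2,
    ContinuousLinearMap.comp_id]

/-! ### Multiplication in the chart, the Lie bracket and the kernel of the adjoint action -/

variable (G) in
/-- Multiplication of a Lie group, read in the preferred chart at the identity. -/
noncomputable def chartMul (z : E × E) : E :=
  extChartAt I (1 : G) ((extChartAt I (1 : G)).symm z.1 * (extChartAt I (1 : G)).symm z.2)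

variable (G) in
theorem contDiffAt_chartMul :
    ContDiffAt ℝ ∞ (chartMul I G) (extChartAt I (1 : G) 1, extChartAt I (1 : G) 1) := by
  rw [← contMDiffAt_iff_contDiffAt]
  have hs : (extChartAt I (1 : G)).symm (extChartAt I (1 : G) 1) = 1 := extChartAt_to_inv _
  have h1 : ContMDiffAt 𝓘(ℝ, E × E) I ∞ (fun z : E × E => (extChartAt I (1 : G)).symm z.1)
      (extChartAt I (1 : G) 1, extChartAt I (1 : G) 1) :=
    ContMDiffAt.comp_of_eq (contMDiffAt_extChartAt_symm_one I G)
      contDiffAt_fst.contMDiffAt rfl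
  have h2 : ContMDiffAt 𝓘(ℝ, E × E) I ∞ (fun z : E × E => (extChartAt I (1 : G)).symm z.2)
      (extChartAt I (1 : G) 1, extChartAt I (1 : G) 1) :=
    ContMDiffAt.comp_of_eq (contMDiffAt_extChartAt_symm_one I G)
      contDiffAt_snd.contMDiffAt rfl
  refine ContMDiffAt.comp_of_eq (y := (1 : G)) (contMDiffAt_extChartAt (x := (1 : G)))
    (h1.mul h2) ?_
  simp

/-- The invariant vector fields, read in the preferred chart at the identity. -/
theorem mpullbackWithin_mulInvariantVectorField (v : E) {p : E}
    (hp : p ∈ (extChartAt I (1 : G)).target) :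
    VectorField.mpullbackWithin 𝓘(ℝ, E) I (extChartAt I (1 : G)).symm
      (mulInvariantVectorField (I := I) (G := G) v) (Set.range I) p =
    fderiv ℝ (fun q => chartMul I G (p, q)) (extChartAt I (1 : G) 1) v := by
  set g : G := (extChartAt I (1 : G)).symm p with hg
  have hsrc : g ∈ (extChartAt I (1 : G)).source := (extChartAt I (1 : G)).map_target hp
  -- Inverting the derivative of the inverse chart gives the derivative of the chart, so the
  -- pulled-back field is the derivative of chart ∘ left translation.
  have hinv := ContinuousLinearMap.inverse_eq
    (mfderivWithin_extChartAt_symm_comp_mfderiv_extChartAt hp)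
    (mfderiv_extChartAt_comp_mfderivWithin_extChartAt_symm hp)
  rw [VectorField.mpullbackWithin_apply, hinv]
  have hL : MDifferentiableAt I I (fun x : G => g * x) 1 :=
    (contMDiff_mul_left (n := ∞)).contMDiffAt.mdifferentiableAt (by simp)
  have he : MDifferentiableAt I 𝓘(ℝ, E) (extChartAt I (1 : G)) g :=
    mdifferentiableAt_extChartAt (by simpa using hsrc)
  have hmul : g * 1 = g := mul_one g
  have hcomp := mfderiv_comp_of_eq he hL hmul
  have hd : MDifferentiableAt I 𝓘(ℝ, E) (extChartAt I (1 : G) ∘ fun x : G => g * x) 1 :=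
    MDifferentiableAt.comp_of_eq _ he hL hmul
  have hfd : mfderiv I 𝓘(ℝ, E) (extChartAt I (1 : G) ∘ fun x : G => g * x) 1 =
      fderiv ℝ (fun q => chartMul I G (p, q)) (extChartAt I (1 : G) 1) := by
    refine hd.mfderiv.trans ?_
    have hu : fderivWithin ℝ (fun q => chartMul I G (p, q)) (Set.range I)
        (extChartAt I (1 : G) 1) =
        fderiv ℝ (fun q => chartMul I G (p, q)) (extChartAt I (1 : G) 1) := by
      rw [I.range_eq_univ, fderivWithin_univ]
    exact hu
  have := congrArg (fun T : E →L[ℝ] E => T v) (hcomp.symm.trans hfd)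
  rw [hmul] at this
  exact this

/-- If the derivative at the identity of left translations minus right translations vanishes in a
direction, then this direction is central in the Lie algebra. -/
theorem lie_eq_zero_of_derivative_eq [CompleteSpace E] {B C : E →L[ℝ] E →L[ℝ] E}
    (hB : HasFDerivAt (fun p => fderiv ℝ (fun q => chartMul I G (p, q)) (extChartAt I (1 : G) 1))
      B (extChartAt I (1 : G) 1))
    (hBC : ∀ v w, C v w = B w v) {v : GroupLieAlgebra I G} (hv : B v = C v)
    (w : GroupLieAlgebra I G) : ⁅v, w⁆ = 0 := by
  have hs : (extChartAt I (1 : G)).symm (extChartAt I (1 : G) 1) = 1 := extChartAt_to_inv _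
  have key : ∀ u : E, VectorField.mpullbackWithin 𝓘(ℝ, E) I (extChartAt I (1 : G)).symm
      (mulInvariantVectorField (I := I) (G := G) u) (Set.range I) =ᶠ[𝓝 (extChartAt I (1 : G) 1)]
      fun p => fderiv ℝ (fun q => chartMul I G (p, q)) (extChartAt I (1 : G) 1) u := by
    intro u
    filter_upwards [extChartAt_target_mem_nhds (I := I) (1 : G)] with p hp
    exact mpullbackWithin_mulInvariantVectorField I u hp
  have hone : fderiv ℝ (fun q => chartMul I G (extChartAt I (1 : G) 1, q))
      (extChartAt I (1 : G) 1) = ContinuousLinearMap.id ℝ E := by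
    rw [← derivAtOne_id I (G := G)]
    simp [derivAtOne, chartMul]
  have hder : ∀ u : E, HasFDerivAt
      (fun p => fderiv ℝ (fun q => chartMul I G (p, q)) (extChartAt I (1 : G) 1) u)
      (B.flip u) (extChartAt I (1 : G) 1) := fun u =>
    (ContinuousLinearMap.apply ℝ E u).hasFDerivAt.comp (extChartAt I (1 : G) 1) hB
  let P : E → E → E := fun u => VectorField.mpullbackWithin 𝓘(ℝ, E) I (extChartAt I (1 : G)).symm
      (mulInvariantVectorField (I := I) (G := G) u) (Set.range I)
  -- At the base point the two fields take the values `v` and `w`, so their bracket is `B v w - B w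
  -- v`.
  have hz : VectorField.lieBracketWithin ℝ (P v) (P w)
      ((extChartAt I (1 : G)).symm ⁻¹' Set.univ ∩ Set.range I) (extChartAt I (1 : G) 1) = 0 := by
    rw [Set.preimage_univ, Set.univ_inter, I.range_eq_univ, VectorField.lieBracketWithin_univ,
      Filter.EventuallyEq.lieBracket_vectorField_eq (key v) (key w), VectorField.lieBracket,
      (hder v).fderiv, (hder w).fderiv, hone]
    have h1 : B v w = B w v := (congrArg (fun T : E →L[ℝ] E => T w) hv).trans (hBC v w)
    exact sub_eq_zero.2 h1
  exact (congrArg (mfderiv I 𝓘(ℝ, E) (extChartAt I (1 : G)) 1).inverse hz).trans (map_zero _)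

/-- In a Lie group with semisimple Lie algebra, the kernel of the adjoint action is discrete. -/
theorem eventually_adjointAction_ne_id [FiniteDimensional ℝ E]
    (hG : IsSemisimpleLieGroup I G) :
    ∀ᶠ h in 𝓝[≠] (1 : G), adjointAction I h ≠ ContinuousLinearMap.id ℝ E := by
  have : CompleteSpace E := FiniteDimensional.complete ℝ E
  have hs : (extChartAt I (1 : G)).symm (extChartAt I (1 : G) 1) = 1 := extChartAt_to_inv _
  obtain ⟨B, C, hB, hC, hBC⟩ := exists_hasFDerivAt_partial
    ((contDiffAt_chartMul I G).of_le (WithTop.coe_le_coe.2 (le_top : (2 : ℕ∞) ≤ ⊤)))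
  have hinj : Function.Injective (B - C) := by
    rw [injective_iff_map_eq_zero]
    intro v hv
    have hv' : B v = C v := sub_eq_zero.1 hv
    let v' : GroupLieAlgebra I G := v
    have hcenter : v' ∈ LieAlgebra.center ℝ (GroupLieAlgebra I G) := by
      rw [LieModule.mem_maxTrivSubmodule]
      intro w
      rw [← lie_skew, lie_eq_zero_of_derivative_eq I hB hBC (v := v') hv' w, neg_zero]
    have hrad : LieAlgebra.radical ℝ (GroupLieAlgebra I G) = ⊥ := hG.radical_eq_bot
    have := LieAlgebra.center_le_radical ℝ (GroupLieAlgebra I G) hcenter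
    rw [hrad] at this
    exact this
  -- In finite dimension an injective derivative is bounded below, so the difference of the two
  -- partial derivatives is nonzero at nearby points other than the base point.
  obtain ⟨K, -, hK⟩ := (B - C : E →ₗ[ℝ] E →L[ℝ] E).exists_antilipschitzWith
    (LinearMap.ker_eq_bot.2 hinj)
  have hne := (hB.sub hC).eventually_ne (c := 0) ⟨K, hK⟩
  rw [eventually_nhdsWithin_iff] at hne ⊢
  have hcont := (continuousAt_extChartAt (I := I) (1 : G)).eventually hne
  filter_upwards [hcont, extChartAt_source_mem_nhds (I := I) (1 : G)] with h hh hsrc hh1 had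
  have hinv : (extChartAt I (1 : G)).symm (extChartAt I (1 : G) h) = h :=
    (extChartAt I (1 : G)).left_inv hsrc
  refine hh (fun heq => hh1 ((extChartAt I (1 : G)).injOn hsrc (mem_extChartAt_source _) heq)) ?_
  rw [Pi.sub_apply, sub_eq_zero]
  have hR : DifferentiableAt ℝ (fun q => chartMul I G (q, extChartAt I (1 : G) h))
      (extChartAt I (1 : G) 1) := by
    rw [← mdifferentiableAt_iff_differentiableAt]
    have h1 : ContMDiffAt 𝓘(ℝ, E) I ∞ (fun q => (extChartAt I (1 : G)).symm q * h)
        (extChartAt I (1 : G) 1) := (contMDiffAt_extChartAt_symm_one I G).mul contMDiffAt_const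
    have h2 := ContMDiffAt.comp_of_eq (y := h) (contMDiffAt_extChartAt' (n := ∞) (x := (1 : G))
      (by simpa using hsrc)) h1 (by simp)
    have h3 := h2.mdifferentiableAt (by simp)
    simpa only [chartMul, hinv, Function.comp_def] using h3
  have hconj := (contDiffAt_chart_of_map_one I (contMDiff_conj I h).contMDiffAt
    (by simp)).differentiableAt (by simp)
  have hval : extChartAt I (1 : G) (h * (extChartAt I (1 : G)).symm (extChartAt I (1 : G) 1) * h⁻¹)
      = extChartAt I (1 : G) 1 := by simp
  have hR' := hR.hasFDerivAt
  rw [← hval] at hR'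
  have hcomp := hR'.comp (extChartAt I (1 : G) 1) hconj.hasFDerivAt
  have hcont' : ContinuousAt (fun q => h * (extChartAt I (1 : G)).symm q * h⁻¹)
      (extChartAt I (1 : G) 1) :=
    ContinuousAt.comp_of_eq (contMDiff_conj I h).continuous.continuousAt
      (contMDiffAt_extChartAt_symm_one I G).continuousAt hs
  have hsrc' : (extChartAt I (1 : G)).source ∈
      𝓝 (h * (extChartAt I (1 : G)).symm (extChartAt I (1 : G) 1) * h⁻¹) := by
    rw [hs, mul_one, mul_inv_cancel]; exact extChartAt_source_mem_nhds _
  -- Since `h * x = (h * x * h⁻¹) * h`, left translation is right translation after conjugation;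
  -- with trivial adjoint action their derivatives at the identity agree.
  have hcomp' := hcomp.congr_of_eventuallyEq
    (f₁ := fun q => chartMul I G (extChartAt I (1 : G) h, q)) (by
      filter_upwards [hcont' hsrc'] with q hq
      have hq' := (extChartAt I (1 : G)).left_inv hq
      simp only at hq'
      simp only [chartMul, Function.comp_apply, hinv, hq', inv_mul_cancel_right])
  rw [hcomp'.fderiv]
  change _ ∘L adjointAction I h = _
  rw [had, ContinuousLinearMap.comp_id, hval]

end LieGroup

/-! ### The strict maximum of the character and the theorem -/

/-- On a compact Lie group with semisimple Lie algebra, the character of the adjoint action has a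
strict local maximum at the identity. -/
theorem eventually_trace_adjointAction_lt {E : Type*} [NormedAddCommGroup E] [NormedSpace ℝ E]
    [FiniteDimensional ℝ E] {H : Type*} [TopologicalSpace H] (I : ModelWithCorners ℝ E H)
    [I.Boundaryless] {G : Type*} [TopologicalSpace G] [ChartedSpace H G] [Group G]
    [LieGroup I ∞ G] [T2Space G] [CompactSpace G] (hG : IsSemisimpleLieGroup I G) :
    ∀ᶠ h in 𝓝[≠] (1 : G), LinearMap.trace ℝ E (adjointAction I h) <
      LinearMap.trace ℝ E (adjointAction I (1 : G)) := by
  have : IsTopologicalGroup G := topologicalGroup_of_lieGroup I ∞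
  obtain ⟨c, hc⟩ := exists_invariant_inner (adjointAction I : G → E →L[ℝ] E)
    (continuous_adjointAction I) (adjointAction_mul I) (adjointAction_one I)
  filter_upwards [eventually_adjointAction_ne_id I hG] with h hh
  rw [adjointAction_one, ContinuousLinearMap.coe_id, LinearMap.trace_id]
  refine LinearMap.trace_lt_finrank_of_inner_invariant c _ (fun x => hc h x x) fun heq => hh ?_
  exact ContinuousLinearMap.coe_injective heq

theorem mainTheorem2
    {E : Type*} [NormedAddCommGroup E] [NormedSpace ℝ E] [FiniteDimensional ℝ E]
    {H : Type*} [TopologicalSpace H] (I : ModelWithCorners ℝ E H) [I.Boundaryless]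
    {G : Type*} [TopologicalSpace G] [ChartedSpace H G] [Group G] [LieGroup I ∞ G]
    [T2Space G] [ConnectedSpace G] [CompactSpace G]
    (hG : IsSemisimpleLieGroup I G)
    (X : (g : G) → TangentSpace I g) (hX : IsLinearVectorField I X)
    (φ : ℝ → G → G) (hφ : IsFlowOf I φ X)
    (g : G) (hg : IsFlowFixedPoint φ g) :
    IsStablePoint φ g := by
  have : CompleteSpace E := FiniteDimensional.complete ℝ E
  have : IsTopologicalGroup G := topologicalGroup_of_lieGroup I ∞
  have : IsManifold I 1 G := IsManifold.of_le (n := ∞) (by simp)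
  obtain ⟨ψ, hψ, haut⟩ := hX.exists_flow
  -- Integral curves of a smooth field on a Hausdorff boundaryless manifold are unique, so the given
  -- flow is the one consisting of automorphisms.
  obtain rfl : φ = ψ := by
    funext t x
    have := isMIntegralCurve_Ioo_eq_of_contMDiff_boundaryless (t₀ := 0)
      (hX.contMDiff.of_le (by simp)) (hφ.isMIntegralCurve x) (hψ.isMIntegralCurve x)
      (by rw [hφ.zero_apply, hψ.zero_apply])
    exact congrFun this t
  refine isStablePoint_of_strict_max hφ.zero_apply (fun x => (hφ.isMIntegralCurve x).continuous)
    (F := fun x => LinearMap.trace ℝ E (adjointAction I (g⁻¹ * x))) ?_ ?_ ?_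
  · have htr : Continuous fun A : E →L[ℝ] E => LinearMap.trace ℝ E (A : E →ₗ[ℝ] E) :=
      ((LinearMap.trace ℝ E).comp (ContinuousLinearMap.coeLM ℝ)).continuous_of_finiteDimensional
    exact htr.comp ((continuous_adjointAction I).comp (continuous_const_mul g⁻¹))
  · intro t x
    rw [← trace_adjointAction_automorphism I (haut t) (g⁻¹ * x)]
    obtain ⟨e, he, -⟩ := haut t
    have hge : e g = g := by rw [he]; exact hg t
    rw [← he, map_mul, map_inv, hge]
  · have hmax := eventually_trace_adjointAction_lt I hG
    rw [eventually_nhdsWithin_iff] at hmax ⊢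
    have htend : Filter.Tendsto (fun x => g⁻¹ * x) (𝓝 g) (𝓝 1) := by
      have := (continuous_const_mul g⁻¹).tendsto g
      rwa [inv_mul_cancel] at this
    filter_upwards [htend.eventually hmax] with x hx hxg
    rw [inv_mul_cancel]
    exact hx fun h => hxg (inv_mul_eq_one.1 h).symm
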